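/- Let $k$ be an algebraically closed field, let $n\ge d\ge 1$ and $D\ge 2$ be integers, and let $\mathcal A=\{\mathbf a_0,\dots,\mathbf a_n\}\subset\mathbb N^d$ be a set of $n+1$ vectors $\mathbf a_i=(a_{i1},\dots,a_{id})$ such that $\{\mathbf 0,D\epsilon_1',\dots,D\epsilon_d'\}\subset\mathcal A$ and $|\mathbf a_i|:=a_{i1}+\dots+a_{id}\le D$ for all $i$, where $\epsilon_1',\dots,\epsilon_d'$ is the canonical basis of $\mathbb N^d$. Let $\underline{\mathcal A}=\{\underline{\mathbf a}_0,\dots,\underline{\mathbf a}_n\}\subset\mathbb N^{d+1}$ with $\underline{\mathbf a}_i=(D-|\mathbf a_i|,a_{i1},\dots,a_{id})$ be the homogenization of $\mathcal A$, and assume that the greatest common divisor of all the coordinates of all the vectors of $\underline{\mathcal A}$ is $1$. Let $\mathcal X_{\underline{\mathcal A}}=V(I_{\underline{\mathcal A}})\subset\mathbb P^n_k$, where $I_{\underline{\mathcal A}}$ is the kernel of the homomorphism of $k$-algebras $k[x_0,\dots,x_n]\to k[t_0,\dots,t_d]$, $x_i\mapsto \mathbf t^{\underline{\mathbf a}_i}$.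 For $s\in\mathbb N$ let $s\mathcal A$ be the set of all sums of $s$ (not necessarily distinct) elements of $\mathcal A$, with $0\mathcal A=\{\mathbf 0\}$, and let $\Delta_s=\{\mathbf y\in\mathbb N^d\mid y_1+\dots+y_d\le sD\}$. The following conditions are equivalent: (a) $\mathcal X_{\underline{\mathcal A}}$ is smooth. (b) $\{\epsilon_i+(D-1)\epsilon_j\mid 0\le i,j\le d\}\subset\underline{\mathcal A}$, where $\epsilon_0,\dots,\epsilon_d$ is the canonical basis of $\mathbb N^{d+1}$. (c) $\{\mathbf 0,\ \epsilon_i',\ (D-1)\epsilon_i',\ \epsilon_i'+(D-1)\epsilon_j'\mid 1\le i,j\le d\}\subset\mathcal A$. (d) There exists $s_0\in\mathbb N$ such that $s\mathcal A=\Delta_s$ for all $s\ge s_0$. -/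

import Mathlib

open CategoryTheory

namespace SimplicialToric

universe u

/-! ### Sumsets -/

/-- The `s`-fold sumset `sA = {a₁ + ⋯ + a_s | a₁, …, a_s ∈ A}`; in particular `0A = {0}`. -/
def sumset {d : ℕ} (s : ℕ) (A : Set (Fin d → ℕ)) : Set (Fin d → ℕ) :=
  {y | ∃ f : Fin s → (Fin d → ℕ), (∀ i, f i ∈ A) ∧ y = ∑ i, f i}

/-- `Δ_s = {y ∈ ℕ^d | y₁ + ⋯ + y_d ≤ sD}`. -/
def simplex (d D s : ℕ) : Set (Fin d → ℕ) :=
  {y | ∑ j, y j ≤ s * D}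

/-- The homogenization `(D - |a|, a₁, …, a_d)` of a vector `a ∈ ℕ^d` with `|a| ≤ D`. -/
def homogenize {d : ℕ} (D : ℕ) (a : Fin d → ℕ) : Fin (d + 1) → ℕ :=
  Fin.cons (D - ∑ j, a j) a

theorem sum_homogenize {d D : ℕ} {a : Fin d → ℕ} (h : ∑ j, a j ≤ D) :
    ∑ j, homogenize D a j = D := by
  simp only [homogenize, Fin.sum_univ_succ, Fin.cons_zero, Fin.cons_succ]
  omega

/-! ### Closed subschemes of projective space -/

section Quotient

variable {k R : Type u} [CommRing k] [CommRing R] [Algebra k R]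
  (𝒜 : ℕ → Submodule k R) [GradedAlgebra 𝒜] (I : HomogeneousIdeal 𝒜)

/-- The grading on `R ⧸ I` for a homogeneous ideal `I` of a graded `k`-algebra `R`:
the degree `i` part is the image of the degree `i` part of `R`. -/
def quotientGrading (i : ℕ) : Submodule k (R ⧸ I.toIdeal) :=
  (𝒜 i).map (Ideal.Quotient.mkₐ k I.toIdeal).toLinearMap

instance quotientGrading_gradedMonoid : SetLike.GradedMonoid (quotientGrading 𝒜 I) where
  one_mem := ⟨1, SetLike.GradedOne.one_mem, map_one (Ideal.Quotient.mkₐ k I.toIdeal)⟩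
  mul_mem := by
    rintro i j _ _ ⟨x, hx, rfl⟩ ⟨y, hy, rfl⟩
    exact ⟨x * y, SetLike.GradedMul.mul_mem hx hy, map_mul (Ideal.Quotient.mkₐ k I.toIdeal) x y⟩

theorem quotientGrading_isInternal : DirectSum.IsInternal (quotientGrading 𝒜 I) := by
  classical
  let q : R →ₗ[k] R ⧸ I.toIdeal := (Ideal.Quotient.mkₐ k I.toIdeal).toLinearMap
  have hq : ∀ x, q x = 0 ↔ x ∈ I.toIdeal := fun x => Ideal.Quotient.eq_zero_iff_mem
  constructor
  · rw [injective_iff_map_eq_zero]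
    intro z hz
    have hx : ∀ i, ∃ x ∈ 𝒜 i, q x = (z i : R ⧸ I.toIdeal) := fun i => (z i).2
    choose x hx hxz using hx
    have hsum : ∑ i ∈ z.support, x i ∈ I.toIdeal := by
      rw [← hq, map_sum, ← hz, DirectSum.coeAddMonoidHom_eq_dfinsuppSum, DFinsupp.sum]
      exact Finset.sum_congr rfl fun i _ => hxz i
    ext i
    by_cases hi : i ∈ z.support
    · have h := I.isHomogeneous i hsum
      rw [DirectSum.decompose_sum, DFinsupp.finsetSum_apply, AddSubmonoidClass.coe_finsetSum,
        Finset.sum_eq_single i] at h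
      · rw [DirectSum.decompose_of_mem_same _ (hx i)] at h
        rw [← hxz i, (hq _).2 h]
        simp
      · intro j _ hj
        exact DirectSum.decompose_of_mem_ne _ (hx j) hj
      · exact fun h => absurd hi h
    · simp only [DFinsupp.mem_support_toFun, ne_eq, not_not] at hi
      simp [hi]
  · intro y
    obtain ⟨x, rfl⟩ := Ideal.Quotient.mk_surjective y
    refine ⟨∑ i ∈ (DirectSum.decompose 𝒜 x).support, DirectSum.of (fun i => quotientGrading 𝒜 I i) i
      ⟨q (DirectSum.decompose 𝒜 x i), _, (DirectSum.decompose 𝒜 x i).2, rfl⟩, ?_⟩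
    rw [map_sum]
    simp only [DirectSum.coeAddMonoidHom_of]
    rw [← map_sum, DirectSum.sum_support_decompose]
    rfl

noncomputable instance quotientGrading_gradedAlgebra : GradedAlgebra (quotientGrading 𝒜 I) where
  toDecomposition := (quotientGrading_isInternal 𝒜 I).chooseDecomposition

end Quotient

section Toric

attribute [local instance] MvPolynomial.gradedAlgebra

/-- The closed subscheme `V(I) = Proj (k[x₀, …, x_n] ⧸ I)` of `ℙⁿ_k` cut out by a homogeneous
ideal `I` of `k[x₀, …, x_n]`. -/
noncomputable def projScheme {k : Type u} [Field k] {n : ℕ}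
    (I : HomogeneousIdeal (MvPolynomial.homogeneousSubmodule (Fin (n + 1)) k)) :
    AlgebraicGeometry.Scheme.{u} :=
  AlgebraicGeometry.Proj (quotientGrading (MvPolynomial.homogeneousSubmodule (Fin (n + 1)) k) I)

/-- The structure morphism `V(I) ⟶ Spec k`. -/
noncomputable def projSchemeToSpec {k : Type u} [Field k] {n : ℕ}
    (I : HomogeneousIdeal (MvPolynomial.homogeneousSubmodule (Fin (n + 1)) k)) :
    projScheme I ⟶ AlgebraicGeometry.Spec (CommRingCat.of k) :=
  AlgebraicGeometry.Proj.toSpecZero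
      (quotientGrading (MvPolynomial.homogeneousSubmodule (Fin (n + 1)) k) I) ≫
    AlgebraicGeometry.Spec.map (CommRingCat.ofHom (algebraMap k
      (quotientGrading (MvPolynomial.homogeneousSubmodule (Fin (n + 1)) k) I 0)))

/-! ### Projective toric varieties -/

/-- The homomorphism of `k`-algebras `k[x₀, …, x_n] → k[t₀, …, t_d]`, `x_i ↦ t^{b_i}`. -/
noncomputable def toricHom (k : Type u) [Field k] {n d : ℕ} (b : Fin (n + 1) → Fin (d + 1) → ℕ) :
    MvPolynomial (Fin (n + 1)) k →ₐ[k] MvPolynomial (Fin (d + 1)) k :=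
  MvPolynomial.aeval fun i => ∏ j, MvPolynomial.X j ^ b i j

theorem toricHom_isHomogeneous (k : Type u) [Field k] {n d D : ℕ}
    {b : Fin (n + 1) → Fin (d + 1) → ℕ} (hb : ∀ i, ∑ j, b i j = D)
    {f : MvPolynomial (Fin (n + 1)) k} {m : ℕ} (hf : f.IsHomogeneous m) :
    (toricHom k b f).IsHomogeneous (D * m) := by
  refine hf.aeval _ fun i => ?_
  rw [← hb i]
  refine MvPolynomial.IsHomogeneous.prod _ _ _ fun j _ => ?_
  simpa using (MvPolynomial.isHomogeneous_X k j).pow (b i j)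

/-- The toric ideal `I_b ⊂ k[x₀, …, x_n]` of vectors `b₀, …, b_n ∈ ℕ^{d+1}` with
`|b_i| = D > 0` for all `i`: the kernel of `x_i ↦ t^{b_i}`. It is a homogeneous ideal. -/
noncomputable def toricIdeal (k : Type u) [Field k] {n d D : ℕ} (hD : 0 < D)
    (b : Fin (n + 1) → Fin (d + 1) → ℕ) (hb : ∀ i, ∑ j, b i j = D) :
    HomogeneousIdeal (MvPolynomial.homogeneousSubmodule (Fin (n + 1)) k) where
  toSubmodule := RingHom.ker (toricHom k b)
  is_homogeneous' := by
    intro m f hf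
    rw [RingHom.mem_ker] at hf ⊢
    change toricHom k b (MvPolynomial.decomposition.decompose' f m) = 0
    rw [MvPolynomial.decomposition.decompose'_apply]
    have h := congrArg (MvPolynomial.homogeneousComponent (D * m)) hf
    rw [map_zero, ← MvPolynomial.sum_homogeneousComponent f, map_sum, map_sum] at h
    by_cases hm : m ∈ Finset.range (f.totalDegree + 1)
    · rw [Finset.sum_eq_single_of_mem m hm] at h
      · rwa [MvPolynomial.homogeneousComponent_of_mem (toricHom_isHomogeneous k hb
          (MvPolynomial.homogeneousComponent_isHomogeneous m f)), if_pos rfl] at h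
      · intro l _ hl
        rw [MvPolynomial.homogeneousComponent_of_mem (toricHom_isHomogeneous k hb
          (MvPolynomial.homogeneousComponent_isHomogeneous l f)), if_neg]
        exact fun h' => hl (Nat.eq_of_mul_eq_mul_left hD h').symm
    · have hlt : f.totalDegree < m := by
        by_contra hle
        exact hm (Finset.mem_range.2 (by omega))
      rw [MvPolynomial.homogeneousComponent_eq_zero _ _ hlt, map_zero]

/-- The projective toric variety `X_b = V(I_b) ⊂ ℙⁿ_k`. -/
noncomputable def toricVariety (k : Type u) [Field k] {n d D : ℕ} (hD : 0 < D)
    (b : Fin (n + 1) → Fin (d + 1) → ℕ) (hb : ∀ i, ∑ j, b i j = D) :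
    AlgebraicGeometry.Scheme.{u} :=
  projScheme (toricIdeal k hD b hb)

/-- The structure morphism `X_b ⟶ Spec k`. -/
noncomputable def toricVarietyToSpec (k : Type u) [Field k] {n d D : ℕ} (hD : 0 < D)
    (b : Fin (n + 1) → Fin (d + 1) → ℕ) (hb : ∀ i, ∑ j, b i j = D) :
    toricVariety k hD b hb ⟶ AlgebraicGeometry.Spec (CommRingCat.of k) :=
  projSchemeToSpec (toricIdeal k hD b hb)

end Toric

end SimplicialToric

/-!
Let `B ⊂ ℕ^(d+1)` be the homogenization of `A`, a set of vectors of degree `D`.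

Then `sA = Δ_s` says that every vector of degree `sD` lies in `sB`, equivalently in the monoid
generated by `B`. If `B` contains the edge vectors `e_i + (D - 1) e_j`, then in large degree some
coordinate `y_j` is large enough to be paired with the residues modulo `D` of the other ones, so
`y` is a sum of edge vectors; conversely, a decomposition of `e_i + (sD - 1) e_j` must use the
edge vector `e_i + (D - 1) e_j`.

The toric variety is covered by the charts at the vertices `D e_j`, which are the spectra of
`k[M_j]`, where `M_j` is generated by the vectors of `B` without their `j`-th coordinate. The edge
vectors make `M_j = ℕ^d`. Conversely, formal smoothness lifts every tangent vector at the point of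
`k[M_j]` where all nonzero monomials vanish to a formal arc, whose order of vanishing is an
additive map `M_j → ℕ ∪ {∞}` equal to `1` on prescribed irreducible elements and at least `2` on
all other nonzero elements. Comparing orders, an irreducible element of `M_j` must lie on a
coordinate axis, with one irreducible `α e_i` for each `i`. Hence `α` divides the `i`-th
coordinate of all vectors of `B`. Comparing the charts at different vertices, it divides all other
coordinates as well, so `α = 1`.
-/

universe u

namespace SimplicialToric

/-! ### Sumsets and the monoid they generate -/

section Sumset

open scoped Pointwise

theorem sumset_eq_nsmul {d : ℕ} (s : ℕ) (A : Set (Fin d → ℕ)) : sumset s A = s • A := by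
  ext y
  simp only [sumset, Set.mem_ofPred_eq, Set.mem_nsmul_iff_sum, eq_comm]

variable {M : Type*} [AddCommMonoid M] {B : Set M} {y : M}

theorem exists_mem_eq_add_of_mem_closure {N : Type*} [AddMonoid N] (f : M →+ N)
    (hy : y ∈ AddSubmonoid.closure B) (hfy : f y ≠ 0) : ∃ b ∈ B, f b ≠ 0 ∧ ∃ c, y = b + c := by
  induction hy using AddSubmonoid.closure_induction with
  | mem y hy => exact ⟨y, hy, hfy, 0, (add_zero y).symm⟩
  | zero => exact absurd (map_zero f) hfy
  | add y z _ _ ihy ihz =>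
    by_cases hy : f y = 0
    · obtain ⟨b, hb, hfb, c, rfl⟩ := ihz (by rwa [map_add, hy, zero_add] at hfy)
      exact ⟨b, hb, hfb, y + c, add_left_comm y b c⟩
    · obtain ⟨b, hb, hfb, c, rfl⟩ := ihy hy
      exact ⟨b, hb, hfb, c + z, add_assoc b c z⟩

theorem mem_closure_iff_exists_mem_nsmul : y ∈ AddSubmonoid.closure B ↔ ∃ s : ℕ, y ∈ s • B := by
  refine ⟨fun hy => ?_,
    fun ⟨s, hy⟩ => AddSubmonoid.closure_nsmul_le (AddSubmonoid.subset_closure hy)⟩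
  induction hy using AddSubmonoid.closure_induction with
  | mem y hy => exact ⟨1, by rwa [one_nsmul]⟩
  | zero => exact ⟨0, by simp⟩
  | add y z _ _ ihy ihz =>
    obtain ⟨s, hs⟩ := ihy
    obtain ⟨t, ht⟩ := ihz
    exact ⟨s + t, add_nsmul B s t ▸ Set.add_mem_add hs ht⟩

end Sumset

/-! ### Monoids generated by vectors of constant degree -/

section ConstantDegree

open scoped Pointwise

variable {ι : Type*} [DecidableEq ι] {D : ℕ}

theorem single_one_add_single_pred (hD : 0 < D) (i : ι) :
    (Pi.single i 1 + Pi.single i (D - 1) : ι → ℕ) = Pi.single i D := by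
  rw [← Pi.single_add, Nat.add_sub_cancel' hD]

theorem single_le_iff {i : ι} {m : ℕ} {x : ι → ℕ} : Pi.single i m ≤ x ↔ m ≤ x i := by
  simp [Pi.single, update_le_iff]

theorem eq_single_of_le_single {i : ι} {m : ℕ} {x : ι → ℕ} (h : x ≤ Pi.single i m) :
    x = Pi.single i (x i) := by
  ext l
  obtain rfl | hl := eq_or_ne l i
  · simp
  · simpa [hl] using h l

variable [Fintype ι] {B : Set (ι → ℕ)}

omit [DecidableEq ι] in
theorem sum_eq_mul_of_mem_nsmul (hdeg : ∀ x ∈ B, ∑ i, x i = D) {s : ℕ} {y : ι → ℕ}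
    (hy : y ∈ s • B) : ∑ i, y i = s * D := by
  obtain ⟨f, hf, rfl⟩ := Set.mem_nsmul_iff_sum.1 hy
  simp only [Finset.sum_apply]
  rw [Finset.sum_comm, Finset.sum_congr rfl fun l _ => hdeg _ (hf l)]
  simp

omit [DecidableEq ι] in
theorem mem_nsmul_iff_mem_closure (hD : 0 < D) (hdeg : ∀ x ∈ B, ∑ i, x i = D) {s : ℕ} {y : ι → ℕ}
    (hy : ∑ i, y i = s * D) : y ∈ s • B ↔ y ∈ AddSubmonoid.closure B := by
  refine ⟨fun h => mem_closure_iff_exists_mem_nsmul.2 ⟨s, h⟩, fun h => ?_⟩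
  obtain ⟨t, ht⟩ := mem_closure_iff_exists_mem_nsmul.1 h
  rwa [Nat.eq_of_mul_eq_mul_right hD (hy.symm.trans (sum_eq_mul_of_mem_nsmul hdeg ht))]

theorem add_single_mem_closure_of_edges (hD : 0 < D)
    (hB : ∀ i j : ι, Pi.single i 1 + Pi.single j (D - 1) ∈ B) (y : ι → ℕ) (j : ι) :
    y + Pi.single j ((D - 1) * ∑ i, y i % D) ∈ AddSubmonoid.closure B := by
  have hedge (i l : ι) : Pi.single i 1 + Pi.single l (D - 1) ∈ AddSubmonoid.closure B :=
    AddSubmonoid.subset_closure (hB i l)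
  have hcoord (i : ι) : Pi.single i (y i) + Pi.single j ((D - 1) * (y i % D)) =
      (y i / D) • (Pi.single i 1 + Pi.single i (D - 1) : ι → ℕ) +
        (y i % D) • (Pi.single i 1 + Pi.single j (D - 1)) := by
    rw [single_one_add_single_pred hD, smul_add, ← add_assoc, ← Pi.single_smul, ← Pi.single_smul,
      ← Pi.single_smul, ← Pi.single_add, smul_eq_mul, smul_eq_mul, smul_eq_mul, mul_one,
      Nat.div_add_mod', mul_comm (D - 1)]
  have hsum : y + Pi.single j ((D - 1) * ∑ i, y i % D) =
      ∑ i, (Pi.single i (y i) + Pi.single j ((D - 1) * (y i % D))) := by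
    rw [Finset.sum_add_distrib, Finset.univ_sum_single, Finset.mul_sum]
    exact congrArg (y + ·) (map_sum (AddMonoidHom.single (fun _ => ℕ) j) _ _)
  rw [hsum]
  refine sum_mem fun i _ => ?_
  rw [hcoord]
  exact add_mem (nsmul_mem (hedge i i) _) (nsmul_mem (hedge i j) _)

theorem add_single_mem_closure_of_large (hD : 0 < D)
    (hB : ∀ i j : ι, Pi.single i 1 + Pi.single j (D - 1) ∈ B) {y : ι → ℕ} {j : ι} {m : ℕ}
    (hm : D * (Fintype.card ι * D) ≤ m) (hdvd : D ∣ ∑ i, y i + m) :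
    y + Pi.single j m ∈ AddSubmonoid.closure B := by
  let r := ∑ i, y i % D
  have hr : D * r ≤ m := by
    refine (Nat.mul_le_mul_left D ?_).trans hm
    simpa using Finset.sum_le_card_nsmul Finset.univ _ D fun i _ => (Nat.mod_lt (y i) hD).le
  have hdvd_r : D ∣ m + r := by
    rw [add_comm m]
    exact ((Nat.ModEq.sum fun i _ => Nat.mod_modEq (y i) D).add_right m).dvd_iff dvd_rfl |>.2 hdvd
  obtain ⟨q, hq⟩ := hdvd_r
  obtain ⟨c, rfl⟩ := Nat.exists_eq_add_of_le <|
    Nat.le_of_mul_le_mul_left (hr.trans (Nat.le_of_add_right_le hq.le)) hD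
  have hm_eq : m = (D - 1) * r + c * D := by
    rw [Nat.sub_one_mul, mul_comm c]
    have := Nat.le_mul_of_pos_left r hD
    rw [mul_add] at hq
    omega
  rw [hm_eq, Pi.single_add, ← add_assoc]
  refine add_mem (add_single_mem_closure_of_edges hD hB y j) ?_
  rw [← smul_eq_mul, Pi.single_smul, ← single_one_add_single_pred hD]
  exact nsmul_mem (AddSubmonoid.subset_closure (hB j j)) c

theorem mem_closure_of_large (hD : 0 < D)
    (hB : ∀ i j : ι, Pi.single i 1 + Pi.single j (D - 1) ∈ B) {y : ι → ℕ} {j : ι}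
    (hj : D * (Fintype.card ι * D) ≤ y j) (hdvd : D ∣ ∑ i, y i) :
    y ∈ AddSubmonoid.closure B := by
  have hy : y - Pi.single j (y j) + Pi.single j (y j) = y :=
    tsub_add_cancel_of_le (single_le_iff.2 le_rfl)
  rw [← hy]
  refine add_single_mem_closure_of_large hD hB hj ?_
  rw [← hy] at hdvd
  simpa [Finset.sum_add_distrib] using hdvd

theorem edge_mem_of_mem_closure (hdeg : ∀ x ∈ B, ∑ i, x i = D) {i j : ι} {m : ℕ}
    (h : Pi.single i 1 + Pi.single j m ∈ AddSubmonoid.closure B) :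
    Pi.single i 1 + Pi.single j (D - 1) ∈ B := by
  obtain ⟨b, hb, hbi, c, hc⟩ := exists_mem_eq_add_of_mem_closure
    (Pi.evalAddMonoidHom (fun _ => ℕ) i) h (by simp)
  have hle : (Pi.single i 1 : ι → ℕ) ≤ b := single_le_iff.2 (Nat.one_le_iff_ne_zero.2 hbi)
  have hrest : b - Pi.single i 1 ≤ Pi.single j m :=
    tsub_le_iff_left.2 (hc ▸ le_self_add)
  obtain ⟨x, rfl⟩ : ∃ x, b = Pi.single i 1 + Pi.single j x :=
    ⟨_, by rw [← eq_single_of_le_single hrest, add_tsub_cancel_of_le hle]⟩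
  have hx : 1 + x = D := by simpa [Finset.sum_add_distrib] using hdeg _ hb
  rwa [← hx, Nat.add_sub_cancel_left]

theorem exists_forall_mem_nsmul_iff [Nonempty ι] (hD : 0 < D) (hdeg : ∀ x ∈ B, ∑ i, x i = D) :
    (∃ s₀ : ℕ, ∀ s ≥ s₀, ∀ y : ι → ℕ, ∑ i, y i = s * D → y ∈ s • B) ↔
      ∀ i j : ι, Pi.single i 1 + Pi.single j (D - 1) ∈ B := by
  constructor
  · rintro ⟨s₀, h⟩ i j
    have hsum : ∑ l, (Pi.single i 1 + Pi.single j ((s₀ + 1) * D - 1) : ι → ℕ) l = (s₀ + 1) * D := by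
      have : 1 ≤ (s₀ + 1) * D := Nat.mul_pos s₀.succ_pos hD
      simp [Finset.sum_add_distrib, Nat.add_sub_cancel' this]
    exact edge_mem_of_mem_closure hdeg
      ((mem_nsmul_iff_mem_closure hD hdeg hsum).1 (h _ s₀.le_succ _ hsum))
  · refine fun hB => ⟨Fintype.card ι * (D * (Fintype.card ι * D)), fun s hs y hy => ?_⟩
    obtain ⟨j, -, hj⟩ : ∃ j ∈ Finset.univ, D * (Fintype.card ι * D) ≤ y j := by
      refine Finset.exists_le_of_sum_le Finset.univ_nonempty ?_
      simpa [hy] using hs.trans (Nat.le_mul_of_pos_right s hD)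
    exact (mem_nsmul_iff_mem_closure hD hdeg hy).2
      (mem_closure_of_large hD hB hj (hy ▸ dvd_mul_left D s))

end ConstantDegree

/-! ### Homogenization -/

section Homogenize

open scoped Pointwise

variable {d D : ℕ}

theorem tail_homogenize (a : Fin d → ℕ) : Fin.tail (homogenize D a) = a := Fin.tail_cons _ _

theorem homogenize_tail {y : Fin (d + 1) → ℕ} (hy : ∑ i, y i = D) :
    homogenize D (Fin.tail y) = y := by
  have hhead : D - ∑ i, Fin.tail y i = y 0 := by
    simp only [← hy, Fin.sum_univ_succ, Fin.tail, Nat.add_sub_cancel]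
  rw [homogenize, hhead, Fin.cons_self_tail]

theorem injOn_tail (N : ℕ) : Set.InjOn Fin.tail {y : Fin (d + 1) → ℕ | ∑ i, y i = N} :=
  Set.LeftInvOn.injOn fun _ hy => homogenize_tail hy

theorem image_tail_sum_eq_mul (s : ℕ) :
    Fin.tail '' {y : Fin (d + 1) → ℕ | ∑ i, y i = s * D} = simplex d D s := by
  ext y
  constructor
  · rintro ⟨y, hy, rfl⟩
    rw [Set.mem_ofPred_eq, Fin.sum_univ_succ] at hy
    exact (Nat.le_add_left _ _).trans hy.le
  · exact fun hy => ⟨homogenize (s * D) y, sum_homogenize hy, tail_homogenize y⟩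

theorem tail_single_zero (m : ℕ) : Fin.tail (Pi.single 0 m : Fin (d + 1) → ℕ) = 0 := by
  ext i
  simp [Fin.tail]

theorem tail_single_succ (i : Fin d) (m : ℕ) :
    Fin.tail (Pi.single i.succ m : Fin (d + 1) → ℕ) = Pi.single i m := by
  ext j
  simp [Fin.tail, Pi.single_apply]

theorem tail_add (x y : Fin (d + 1) → ℕ) : Fin.tail (x + y) = Fin.tail x + Fin.tail y := rfl

variable {κ : Type*} {a : κ → Fin d → ℕ} (hdeg : ∀ l, ∑ j, a l j ≤ D)
include hdeg

theorem mem_range_homogenize_iff {y : Fin (d + 1) → ℕ} :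
    y ∈ Set.range (fun l => homogenize D (a l)) ↔ ∑ i, y i = D ∧ Fin.tail y ∈ Set.range a := by
  constructor
  · rintro ⟨l, rfl⟩
    exact ⟨sum_homogenize (hdeg l), l, (tail_homogenize _).symm⟩
  · rintro ⟨hy, l, hl⟩
    exact ⟨l, by simp only [hl, homogenize_tail hy]⟩

theorem single_mem_range_homogenize (hzero : 0 ∈ Set.range a)
    (hvert : ∀ i : Fin d, Pi.single i D ∈ Set.range a) (i : Fin (d + 1)) :
    Pi.single i D ∈ Set.range (fun l => homogenize D (a l)) := by
  refine (mem_range_homogenize_iff hdeg).2 ⟨by simp, ?_⟩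
  induction i using Fin.cases with
  | zero => rwa [tail_single_zero]
  | succ i => exact tail_single_succ i D ▸ hvert i

theorem single_add_single_mem_range_homogenize_iff (hD : 0 < D) (i j : Fin (d + 1)) :
    Pi.single i 1 + Pi.single j (D - 1) ∈ Set.range (fun l => homogenize D (a l)) ↔
      Fin.tail (Pi.single i 1 : Fin (d + 1) → ℕ) + Fin.tail (Pi.single j (D - 1) : Fin (d + 1) → ℕ)
        ∈ Set.range a := by
  rw [mem_range_homogenize_iff hdeg, ← tail_add, and_iff_right]
  simp [Finset.sum_add_distrib, Nat.add_sub_cancel' hD]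

theorem forall_single_add_single_mem_iff (hD : 0 < D) :
    (∀ i j : Fin (d + 1),
      Pi.single i 1 + Pi.single j (D - 1) ∈ Set.range (fun l => homogenize D (a l))) ↔
    0 ∈ Set.range a ∧
      (∀ i : Fin d, Pi.single i 1 ∈ Set.range a ∧ Pi.single i (D - 1) ∈ Set.range a) ∧
      ∀ i j : Fin d, Pi.single i 1 + Pi.single j (D - 1) ∈ Set.range a := by
  simp only [single_add_single_mem_range_homogenize_iff hdeg hD, Fin.forall_fin_succ,
    tail_single_zero, tail_single_succ, zero_add, add_zero, and_assoc, forall_and]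

theorem sumset_eq_simplex_iff (s : ℕ) :
    sumset s (Set.range a) = simplex d D s ↔ ∀ y : Fin (d + 1) → ℕ, ∑ i, y i = s * D →
      y ∈ s • Set.range fun l => homogenize D (a l) := by
  set B := Set.range fun l => homogenize D (a l) with hB
  have htail : Fin.tail '' (s • B) = sumset s (Set.range a) := by
    rw [sumset_eq_nsmul]
    refine (Set.image_nsmul (LinearMap.funLeft ℕ ℕ Fin.succ) B s).trans (congrArg (s • ·) ?_)
    rw [hB, ← Set.range_comp]
    exact congrArg Set.range (funext fun l => tail_homogenize (D := D) (a l))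
  have hdegB : s • B ⊆ {y | ∑ i, y i = s * D} := fun y =>
    sum_eq_mul_of_mem_nsmul (Set.forall_mem_range.2 fun l => sum_homogenize (hdeg l))
  rw [← htail, ← image_tail_sum_eq_mul, (injOn_tail (s * D)).image_eq_image_iff hdegB subset_rfl]
  exact ⟨fun h y hy => h ▸ hy, hdegB.antisymm⟩

theorem exists_forall_sumset_eq_simplex_iff (hD : 0 < D) :
    (∃ s₀ : ℕ, ∀ s ≥ s₀, sumset s (Set.range a) = simplex d D s) ↔
      ∀ i j : Fin (d + 1),
        Pi.single i 1 + Pi.single j (D - 1) ∈ Set.range (fun l => homogenize D (a l)) := by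
  simp only [sumset_eq_simplex_iff hdeg]
  exact exists_forall_mem_nsmul_iff hD (Set.forall_mem_range.2 fun l => sum_homogenize (hdeg l))

end Homogenize

/-! ### Formally smooth monoid algebras -/

section FormallySmooth

theorem isAdicComplete_pow {R : Type*} [CommRing R] {I : Ideal R} [IsAdicComplete I R] {n : ℕ}
    (hn : 0 < n) : IsAdicComplete (I ^ n) R := by
  let _ := I.adicTopology
  let _ := IsTopologicalAddGroup.rightUniformSpace R
  have := isUniformAddGroup_of_addCommGroup (G := R)
  have hI : IsAdic I := rfl
  exact (is_ideal_adic_pow hI hn).isAdicComplete_iff.2 (hI.isAdicComplete_iff.1 inferInstance)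

theorem ne_zero_of_addIrreducible {M : Type*} [AddMonoid M] {m : M}
    (hm : AddIrreducible m) : m ≠ 0 :=
  fun h => hm.not_isAddUnit (h ▸ isAddUnit_zero)

variable {M : Type*} [AddCommMonoid M] [Subsingleton (AddUnits M)]

open Classical in
/-- The multiplicative map `M → R` sending `0` to `1`, the elements of a set `T` of irreducible
elements to a square-zero element `e`, and everything else to `0`. For `e = ε` in the dual numbers
it is a tangent vector of `Spec k[M]` at the point where all nonzero elements of `M` vanish. -/
noncomputable def tangentHom {R : Type*} [CommRing R] {T : Set M}
    (hT : ∀ m ∈ T, AddIrreducible m) {e : R} (he : e * e = 0) : Multiplicative M →* R where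
  toFun m := if m.toAdd = 0 then 1 else if m.toAdd ∈ T then e else 0
  map_one' := by simp
  map_mul' x y := by
    by_cases hx : x.toAdd = 0
    · simp [hx]
    by_cases hy : y.toAdd = 0
    · simp [hy]
    have hxy : x.toAdd + y.toAdd ≠ 0 := fun h => hx (add_eq_zero.1 h).1
    have hxyT : x.toAdd + y.toAdd ∉ T := fun h =>
      ((hT _ h).isAddUnit_or_isAddUnit rfl).elim (fun h => hx (isAddUnit_iff_eq_zero.1 h))
        fun h => hy (isAddUnit_iff_eq_zero.1 h)
    rw [toAdd_mul, if_neg hxy, if_neg hxyT, if_neg hx, if_neg hy]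
    split_ifs <;> simp [he]

open PowerSeries in
/-- A tangent vector at the origin of a formally smooth `Spec k[M]` lifts to a formal arc. -/
theorem exists_arc (k : Type*) [Field k] [Algebra.FormallySmooth k (AddMonoidAlgebra k M)]
    {T : Set M} (hT : ∀ m ∈ T, AddIrreducible m) :
    ∃ φ : AddMonoidAlgebra k M →ₐ[k] k⟦X⟧,
      (∀ m ∈ T, X ^ 2 ∣ φ (.single m 1) - X) ∧
      ∀ m, m ≠ 0 → m ∉ T → X ^ 2 ∣ φ (.single m 1) := by
  let I : Ideal k⟦X⟧ := Ideal.span {X} ^ 2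
  have : IsAdicComplete I k⟦X⟧ := isAdicComplete_pow two_pos
  have hmem {f : k⟦X⟧} : f ∈ I ↔ X ^ 2 ∣ f := by
    simp only [I, Ideal.span_singleton_pow, Ideal.mem_span_singleton]
  have he : Ideal.Quotient.mk I X * Ideal.Quotient.mk I X = 0 := by
    rw [← map_mul, ← sq, Ideal.Quotient.eq_zero_iff_mem, hmem]
  obtain ⟨φ, hφ⟩ := Algebra.FormallySmooth.exists_mkₐ_comp_eq_of_isAdicComplete (I := I)
    (AddMonoidAlgebra.lift k _ M (tangentHom hT he))
  have hφ_single (m : M) :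
      Ideal.Quotient.mk I (φ (.single m 1)) = tangentHom hT he (.ofAdd m) := by
    simpa using AlgHom.congr_fun hφ (.single m 1)
  refine ⟨φ, fun m hm => ?_, fun m hm₀ hm => ?_⟩
  · rw [← hmem, ← Ideal.Quotient.eq, hφ_single]
    simp [tangentHom, ne_zero_of_addIrreducible (hT m hm), hm]
  · rw [← hmem, ← Ideal.Quotient.eq_zero_iff_mem, hφ_single]
    simp [tangentHom, hm₀, hm]

theorem exists_addMonoidHom_of_formallySmooth (k : Type*) [Field k]
    [Algebra.FormallySmooth k (AddMonoidAlgebra k M)] {T : Set M}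
    (hT : ∀ m ∈ T, AddIrreducible m) :
    ∃ v : M →+ ℕ∞, (∀ m ∈ T, v m = 1) ∧ ∀ m, m ≠ 0 → m ∉ T → 2 ≤ v m := by
  obtain ⟨φ, hφ, hφ'⟩ := exists_arc k hT
  let v : M →+ ℕ∞ :=
    { toFun := fun m => (φ (.single m 1)).order
      map_zero' := by rw [← AddMonoidAlgebra.one_def, map_one, PowerSeries.order_one]
      map_add' := fun x y => by
        rw [← PowerSeries.order_mul, ← map_mul, AddMonoidAlgebra.single_mul_single, one_mul] }
  refine ⟨v, fun m hm => PowerSeries.order_eq_nat.2 ?_, fun m hm₀ hm => ?_⟩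
  · have h := PowerSeries.X_pow_dvd_iff.1 (hφ m hm)
    have h₀ : PowerSeries.coeff 0 (φ (.single m 1)) = 0 := by
      simpa [PowerSeries.coeff_X] using h 0 two_pos
    have h₁ : PowerSeries.coeff 1 (φ (.single m 1)) = 1 := by
      simpa [PowerSeries.coeff_X, sub_eq_zero] using h 1 one_lt_two
    simp [h₀, h₁]
  · exact PowerSeries.nat_le_order _ 2 (PowerSeries.X_pow_dvd_iff.1 (hφ' m hm₀ hm))

/-- If `c` is not among the `w i`, the orders of vanishing along an arc tangent to `c` only give
`n ≥ 2 ∑ m_i`, and those along an arc tangent to exactly the `w i` give `∑ m_i ≥ 2 n`. -/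
theorem exists_eq_of_nsmul_eq_sum_nsmul (k : Type*) [Field k]
    [Algebra.FormallySmooth k (AddMonoidAlgebra k M)] {ι : Type*} {t : Finset ι} {w : ι → M} {c : M}
    (hc : AddIrreducible c) (hw : ∀ i ∈ t, AddIrreducible (w i)) {n : ℕ} (hn : n ≠ 0) {m : ι → ℕ}
    (h : n • c = ∑ i ∈ t, m i • w i) : ∃ i ∈ t, c = w i := by
  by_contra! hcw
  have hle : 2 * ∑ i ∈ t, m i ≤ n := by
    obtain ⟨v, hvc, hv⟩ := exists_addMonoidHom_of_formallySmooth k (T := {c}) (by simpa using hc)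
    have hvw : ∀ i ∈ t, 2 ≤ v (w i) := fun i hi =>
      hv _ (ne_zero_of_addIrreducible (hw i hi)) (hcw i hi).symm
    have hsum : (n : ℕ∞) = ∑ i ∈ t, m i • v (w i) := by
      simpa [hvc c rfl] using congrArg v h
    have hle := Finset.sum_le_sum fun i hi => nsmul_le_nsmul_right (hvw i hi) (m i)
    simp only [nsmul_eq_mul, ← Finset.sum_mul] at hle hsum
    rw [← hsum, mul_comm] at hle
    exact_mod_cast hle
  have hle' : 2 * n ≤ ∑ i ∈ t, m i := by
    obtain ⟨v, hvw, hv⟩ := exists_addMonoidHom_of_formallySmooth k (T := w '' t)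
      (by simpa using hw)
    have hvc : 2 ≤ v c := hv c (ne_zero_of_addIrreducible hc) fun ⟨i, hi, hic⟩ => hcw i hi hic.symm
    have hsum : n • v c = ∑ i ∈ t, (m i : ℕ∞) := by
      rw [← map_nsmul, h, map_sum]
      exact Finset.sum_congr rfl fun i hi => by simp [hvw _ ⟨i, hi, rfl⟩]
    have hle := nsmul_le_nsmul_right hvc n
    rw [hsum, nsmul_eq_mul, mul_comm] at hle
    exact_mod_cast hle
  omega

end FormallySmooth

section Axis

instance instSubsingletonAddUnitsAddSubmonoid {M : Type*} [AddMonoid M] [Subsingleton (AddUnits M)]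
    (S : AddSubmonoid M) : Subsingleton (AddUnits S) :=
  (AddUnits.map_injective (f := S.subtype) Subtype.val_injective).subsingleton

theorem closure_addIrreducible_eq_top {M : Type*} [AddCommMonoid M] [IsCancelAdd M]
    [Subsingleton (AddUnits M)] [AddMonoid.FG M] :
    AddSubmonoid.closure {m : M | AddIrreducible m} = ⊤ :=
  let _ : AddCancelCommMonoid M := { add_left_cancel := fun _ _ _ => add_left_cancel }
  AddSubmonoid.closure_addIrreducible

variable {σ : Type*}

theorem exists_addIrreducible_coe_eq_single {S : AddSubmonoid (σ →₀ ℕ)} [AddMonoid.FG S] {i : σ}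
    {m : ℕ} (hm : m ≠ 0) (hS : Finsupp.single i m ∈ S) :
    ∃ w : S, AddIrreducible w ∧ ∃ a ≠ 0, (w : σ →₀ ℕ) = Finsupp.single i a := by
  have hmem : (⟨_, hS⟩ : S) ∈ AddSubmonoid.closure {w : S | AddIrreducible w} :=
    closure_addIrreducible_eq_top.ge trivial
  obtain ⟨w, hw, hwi, c, hc⟩ := exists_mem_eq_add_of_mem_closure
    ((Finsupp.applyAddHom i).comp S.subtype) hmem (by simpa using hm)
  have hle : (w : σ →₀ ℕ) ≤ Finsupp.single i m := by
    rw [show Finsupp.single i m = (w : σ →₀ ℕ) + c from congrArg Subtype.val hc]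
    exact le_self_add
  refine ⟨w, hw, _, hwi, Finsupp.support_subset_singleton.1 ?_⟩
  exact (Finsupp.support_mono hle).trans Finsupp.support_single_subset

theorem exists_eq_of_addIrreducible [Finite σ] (k : Type*) [Field k] {S : AddSubmonoid (σ →₀ ℕ)}
    [Algebra.FormallySmooth k (AddMonoidAlgebra k S)] {w : σ → S}
    (hw : ∀ i, AddIrreducible (w i)) {α : σ → ℕ} (hα : ∀ i, α i ≠ 0)
    (hwα : ∀ i, (w i : σ →₀ ℕ) = Finsupp.single i (α i)) {c : S} (hc : AddIrreducible c) :
    ∃ i, c = w i := by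
  classical
  have := Fintype.ofFinite σ
  suffices h : (∏ i, α i) • c = ∑ i, ((c : σ →₀ ℕ) i * ∏ j ∈ Finset.univ.erase i, α j) • w i by
    obtain ⟨i, -, hi⟩ := exists_eq_of_nsmul_eq_sum_nsmul k hc (fun i _ => hw i)
      (Finset.prod_ne_zero_iff.2 fun i _ => hα i) h
    exact ⟨i, hi⟩
  ext j
  simp [hwα, Finsupp.single_apply, mul_assoc, Finset.prod_erase_mul, mul_comm ((c : σ →₀ ℕ) j)]

theorem exists_single_mem_forall_dvd [Finite σ] (k : Type*) [Field k] {G : Set (σ →₀ ℕ)}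
    (hG : G.Finite) [Algebra.FormallySmooth k (AddMonoidAlgebra k (AddSubmonoid.closure G))]
    (haxis : ∀ i, ∃ m ≠ 0, Finsupp.single i m ∈ AddSubmonoid.closure G) (i : σ) :
    ∃ α ≠ 0, Finsupp.single i α ∈ G ∧ ∀ y ∈ G, α ∣ y i := by
  have : AddMonoid.FG (AddSubmonoid.closure G) :=
    (AddMonoid.fg_iff_addSubmonoid_fg _).2 ⟨hG.toFinset, by simp⟩
  choose m hm hmS using haxis
  choose w hw α hα hwα using fun i => exists_addIrreducible_coe_eq_single (hm i) (hmS i)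
  refine ⟨α i, hα i, ?_, fun y hy => ?_⟩
  · rw [← hwα i]
    exact addIrreducible_subset_of_addSubmonoidClosure_eq_top (S := Subtype.val ⁻¹' G)
      AddSubmonoid.closure_closure_coe_preimage (hw i)
  · have hmem : (⟨y, AddSubmonoid.subset_closure hy⟩ : AddSubmonoid.closure G) ∈
        AddSubmonoid.closure {c | AddIrreducible c} := closure_addIrreducible_eq_top.ge trivial
    suffices h : ∀ z ∈ AddSubmonoid.closure {c : AddSubmonoid.closure G | AddIrreducible c},
      α i ∣ (z : σ →₀ ℕ) i from h _ hmem
    intro z hz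
    induction hz using AddSubmonoid.closure_induction with
    | mem c hc =>
      obtain ⟨j, rfl⟩ := exists_eq_of_addIrreducible k hw hα hwα hc
      rw [hwα]
      obtain rfl | hij := eq_or_ne i j
      · simp
      · simp [Finsupp.single_eq_of_ne hij]
    | zero => exact dvd_zero _
    | add x z _ _ hx hz => exact dvd_add hx hz

end Axis

/-! ### Smoothness and dehomogenization for projective spectra -/

section Graded

open HomogeneousLocalization

instance instAlgebraHomogeneousLocalization {R A : Type*} [CommRing R] [CommRing A] [Algebra R A]
    (𝒜 : ℕ → Submodule R A) [GradedAlgebra 𝒜] (S : Submonoid A) :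
    Algebra R (HomogeneousLocalization 𝒜 S) where
  algebraMap := (fromZeroRingHom 𝒜 S).comp (algebraMap R (𝒜 0))
  commutes' _ _ := mul_comm _ _
  smul_def' r x := by
    ext
    rw [val_smul, val_mul, Algebra.smul_def, IsScalarTower.algebraMap_apply R A (Localization S)]
    rfl

instance instIsScalarTowerHomogeneousLocalization {R A : Type*} [CommRing R] [CommRing A]
    [Algebra R A] (𝒜 : ℕ → Submodule R A) [GradedAlgebra 𝒜] (S : Submonoid A) :
    IsScalarTower R (HomogeneousLocalization 𝒜 S) (Localization S) where
  smul_assoc r x y := by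
    rw [Algebra.smul_def, Algebra.smul_def x, HomogeneousLocalization.algebraMap_apply,
      HomogeneousLocalization.algebraMap_apply, val_smul, smul_mul_assoc]

open AlgebraicGeometry in
theorem smooth_toSpecZero_comp_iff {R A : Type u} [CommRing R] [CommRing A] [Algebra R A]
    (𝒜 : ℕ → Submodule R A) [GradedAlgebra 𝒜] {ι : Type*} {f : ι → A} {m : ι → ℕ}
    (hf : ∀ i, f i ∈ 𝒜 (m i)) (hm : ∀ i, 0 < m i) (hcover : ⨆ i, Proj.basicOpen 𝒜 (f i) = ⊤) :
    Smooth (Proj.toSpecZero 𝒜 ≫ Spec.map (CommRingCat.ofHom (algebraMap R (𝒜 0)))) ↔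
      ∀ i, Algebra.Smooth R (Away 𝒜 (f i)) := by
  have : IsZariskiLocalAtSource @Smooth.{u} :=
    HasRingHomProperty.instIsZariskiLocalAtSource (Q := RingHom.Smooth)
  have : MorphismProperty.RespectsIso @Smooth.{u} :=
    MorphismProperty.IsStableUnderBaseChange.respectsIso
  rw [IsZariskiLocalAtSource.iff_of_iSup_eq_top (P := @Smooth.{u}) _ hcover]
  refine forall_congr' fun i => ?_
  rw [← MorphismProperty.cancel_left_of_respectsIso @Smooth.{u}
    (Proj.basicOpenIsoSpec 𝒜 (f i) (hf i) (hm i)).inv, Proj.basicOpenIsoSpec_inv_ι_assoc,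
    Proj.awayι_toSpecZero_assoc, ← Spec.map_comp, ← CommRingCat.ofHom_comp,
    HasRingHomProperty.Spec_iff (P := @Smooth.{u})]
  exact RingHom.smooth_algebraMap

variable {R A B : Type*} [CommRing R] [CommRing A] [Algebra R A] [CommRing B] [Algebra R B]
  (𝒜 : ℕ → Submodule R A) [GradedAlgebra 𝒜] {φ : A →ₐ[R] B} {f : A}

/-- The dehomogenization `x / f ^ m ↦ φ x` of an algebra homomorphism `φ` with `φ f = 1`. -/
noncomputable def awayEval (hφf : φ f = 1) : Away 𝒜 f →ₐ[R] B :=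
  (IsLocalization.liftAlgHom (M := Submonoid.powers f) (S := Localization.Away f) (f := φ) <| by
    rintro ⟨_, m, rfl⟩
    simp [hφf]).comp (IsScalarTower.toAlgHom R (Away 𝒜 f) (Localization.Away f))

theorem awayEval_mk (hφf : φ f = 1) (c : NumDenSameDeg 𝒜 (Submonoid.powers f)) :
    awayEval 𝒜 hφf (HomogeneousLocalization.mk c) = φ c.num := by
  obtain ⟨m, hm⟩ := c.den_mem
  have hden : φ c.den = 1 := by rw [← hm, map_pow, hφf, one_pow]
  rw [awayEval, AlgHom.comp_apply, IsScalarTower.coe_toAlgHom',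
    HomogeneousLocalization.algebraMap_apply, val_mk, Localization.mk_eq_mk',
    IsLocalization.liftAlgHom_apply, IsLocalization.lift_mk'_spec]
  exact (one_mul _).symm.trans (congrArg (· * φ c.num) hden.symm)

theorem awayEval_injective (hφf : φ f = 1) (hφ : ∀ m, Set.InjOn φ (𝒜 m)) :
    Function.Injective (awayEval 𝒜 hφf) := by
  rw [injective_iff_map_eq_zero]
  intro x hx
  obtain ⟨c, rfl⟩ := mk_surjective x
  rw [awayEval_mk] at hx
  exact mk_eq_zero_of_num c (Subtype.ext (hφ c.deg c.num.2 (zero_mem _) (by simpa using hx)))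

theorem range_awayEval (hf : f ∈ 𝒜 1) (hφf : φ f = 1) : (awayEval 𝒜 hφf).range = φ.range := by
  apply le_antisymm
  · rintro _ ⟨x, rfl⟩
    obtain ⟨c, rfl⟩ := mk_surjective x
    exact ⟨c.num, (awayEval_mk 𝒜 hφf c).symm⟩
  · rintro _ ⟨x, rfl⟩
    induction x using DirectSum.Decomposition.inductionOn 𝒜 with
    | zero => exact ⟨0, by simp⟩
    | add x y hx hy => simpa using add_mem hx hy
    | @homogeneous m x =>
      have hfm : f ^ m ∈ 𝒜 m := by simpa using SetLike.pow_mem_graded m hf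
      exact ⟨HomogeneousLocalization.mk ⟨m, x, ⟨f ^ m, hfm⟩, m, rfl⟩, awayEval_mk 𝒜 hφf _⟩

/-- The coordinate ring of a degree-one chart, identified by dehomogenization. -/
noncomputable def awayEquivRange (hf : f ∈ 𝒜 1) (hφf : φ f = 1) (hφ : ∀ m, Set.InjOn φ (𝒜 m)) :
    Away 𝒜 f ≃ₐ[R] φ.range :=
  (AlgEquiv.ofInjective _ (awayEval_injective 𝒜 hφf hφ)).trans
    (Subalgebra.equivOfEq _ _ (range_awayEval 𝒜 hf hφf))

end Graded

/-! ### Charts of projective toric varieties -/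

section ChartExponent

variable {σ : Type*}

/-- The exponent vector `y` without its `j`-th coordinate. -/
noncomputable def chartExponent [Finite σ] (j : σ) : (σ → ℕ) →+ ({i // i ≠ j} →₀ ℕ) where
  toFun y := Finsupp.equivFunOnFinite.symm fun i => y i
  map_zero' := by ext; rfl
  map_add' _ _ := by ext; rfl

@[simp]
theorem chartExponent_apply [Finite σ] (j : σ) (y : σ → ℕ) (i : {i // i ≠ j}) :
    chartExponent j y i = y i := rfl

theorem chartExponent_injOn [Fintype σ] (j : σ) (N : ℕ) :
    Set.InjOn (chartExponent j) {y | ∑ i, y i = N} := by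
  classical
  intro y hy z hz h
  have hne (i : σ) (hi : i ≠ j) : y i = z i := DFunLike.congr_fun h ⟨i, hi⟩
  have hj : y j = z j := by
    have hsum := hy.trans hz.symm
    rwa [Fintype.sum_eq_add_sum_compl j, Fintype.sum_eq_add_sum_compl j,
      Finset.sum_congr rfl fun i hi => hne i (by simpa using hi), add_left_inj] at hsum
  ext i
  obtain rfl | hi := eq_or_ne i j
  exacts [hj, hne i hi]

variable [Finite σ] [DecidableEq σ]

theorem chartExponent_single_self (j : σ) (m : ℕ) : chartExponent j (Pi.single j m) = 0 := by
  ext i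
  simp [i.2]

theorem chartExponent_single {j : σ} (i : {i // i ≠ j}) (m : ℕ) :
    chartExponent j (Pi.single i m) = Finsupp.single i m := by
  ext l
  simp [Finsupp.single_apply, Pi.single_apply, eq_comm, Subtype.ext_iff]

end ChartExponent

section Dehomogenize

variable (k : Type*) [CommSemiring k] {σ : Type*}

/-- Setting the variable `t_j` equal to `1`. -/
noncomputable def dehomogenize [Finite σ] (j : σ) :
    MvPolynomial σ k →ₐ[k] MvPolynomial {i // i ≠ j} k :=
  AddMonoidAlgebra.mapDomainAlgHom k k ((chartExponent j).comp Finsupp.coeFnAddHom)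

theorem dehomogenize_monomial [Finite σ] (j : σ) (m : σ →₀ ℕ) (r : k) :
    dehomogenize k j (MvPolynomial.monomial m r) = MvPolynomial.monomial (chartExponent j m) r :=
  AddMonoidAlgebra.mapDomain_single

theorem dehomogenize_injOn [Finite σ] (j : σ) (N : ℕ) :
    Set.InjOn (dehomogenize k j) {p | p.IsHomogeneous N} := by
  have := Fintype.ofFinite σ
  have hexp : Set.InjOn (fun m : σ →₀ ℕ => chartExponent j m) {m | m.degree = N} :=
    (chartExponent_injOn j N).comp DFunLike.coe_injective.injOn fun m hm => by
      simpa [Finsupp.degree_eq_sum] using hm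
  have hsupp {p : MvPolynomial σ k} (hp : p.IsHomogeneous N) :
      ((AddMonoidAlgebra.coeff p).support : Set (σ →₀ ℕ)) ⊆ {m | m.degree = N} :=
    fun m hm => of_not_not fun hne => Finsupp.mem_support_iff.1 hm (hp.coeff_eq_zero hne)
  intro p hp q hq h
  exact AddMonoidAlgebra.coeff_injective <|
    Finsupp.mapDomain_injOn _ hexp (hsupp hp) (hsupp hq) (congrArg AddMonoidAlgebra.coeff h)

end Dehomogenize

theorem single_mem_adjoin_of_mem_closure {k : Type*} [CommSemiring k] {M : Type*} [AddCommMonoid M]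
    {G : Set M} {s : M} (hs : s ∈ AddSubmonoid.closure G) :
    AddMonoidAlgebra.single s (1 : k) ∈
      Algebra.adjoin k ((fun g => AddMonoidAlgebra.single g (1 : k)) '' G) := by
  induction hs using AddSubmonoid.closure_induction with
  | mem g hg => exact Algebra.subset_adjoin ⟨g, hg, rfl⟩
  | zero => exact one_mem _
  | add s t _ _ hs ht => simpa [AddMonoidAlgebra.single_mul_single] using mul_mem hs ht

theorem range_mapDomainAlgHom_closure (k : Type*) [CommSemiring k] {M : Type*} [AddCommMonoid M]
    (G : Set M) :
    (AddMonoidAlgebra.mapDomainAlgHom k k (AddSubmonoid.closure G).subtype).range =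
      Algebra.adjoin k ((fun g => AddMonoidAlgebra.single g (1 : k)) '' G) := by
  apply le_antisymm
  · rintro _ ⟨x, rfl⟩
    change AddMonoidAlgebra.mapDomainAlgHom k k (AddSubmonoid.closure G).subtype x ∈ _
    induction x using AddMonoidAlgebra.induction_linear with
    | zero => rw [map_zero]; exact zero_mem _
    | add x y hx hy => rw [map_add]; exact add_mem hx hy
    | single s r =>
      have h := Subalgebra.smul_mem _ (single_mem_adjoin_of_mem_closure (k := k) s.2) r
      simpa [AddMonoidAlgebra.smul_single] using h
  · rw [Algebra.adjoin_le_iff]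
    rintro _ ⟨g, hg, rfl⟩
    exact ⟨AddMonoidAlgebra.single ⟨g, AddSubmonoid.subset_closure hg⟩ 1,
      AddMonoidAlgebra.mapDomain_single⟩

section Toric

attribute [local instance] MvPolynomial.gradedAlgebra

variable (k : Type u) [Field k] {n d D : ℕ} (hD : 0 < D)
  (b : Fin (n + 1) → Fin (d + 1) → ℕ) (hb : ∀ i, ∑ j, b i j = D)

/-- The homogeneous coordinate ring of `X_b`. -/
abbrev toricRing : Type u := MvPolynomial (Fin (n + 1)) k ⧸ (toricIdeal k hD b hb).toIdeal

/-- The grading on the homogeneous coordinate ring of `X_b`. -/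
noncomputable abbrev toricGrading : ℕ → Submodule k (toricRing k hD b hb) :=
  quotientGrading (MvPolynomial.homogeneousSubmodule (Fin (n + 1)) k) (toricIdeal k hD b hb)

/-- The homogeneous coordinate `x_l` on `X_b`. -/
noncomputable def toricCoord (l : Fin (n + 1)) : toricRing k hD b hb :=
  Ideal.Quotient.mk _ (MvPolynomial.X l)

/-- The embedding `x_l ↦ t^{b_l}` of the homogeneous coordinate ring of `X_b` into
`k[t₀, …, t_d]`. -/
noncomputable def toricEval : toricRing k hD b hb →ₐ[k] MvPolynomial (Fin (d + 1)) k :=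
  Ideal.Quotient.liftₐ _ (toricHom k b) fun _ ha => ha

theorem toricEval_injective : Function.Injective (toricEval k hD b hb) :=
  RingHom.kerLift_injective (toricHom k b).toRingHom

theorem toricEval_coord (l : Fin (n + 1)) : toricEval k hD b hb (toricCoord k hD b hb l) =
    MvPolynomial.monomial (Finsupp.equivFunOnFinite.symm (b l)) 1 := by
  change MvPolynomial.aeval _ (MvPolynomial.X l) = _
  rw [MvPolynomial.aeval_X, MvPolynomial.monomial_eq, Finsupp.prod_fintype _ _ (by simp)]
  simp

theorem toricCoord_mem (l : Fin (n + 1)) : toricCoord k hD b hb l ∈ toricGrading k hD b hb 1 :=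
  ⟨MvPolynomial.X l, MvPolynomial.isHomogeneous_X k l, rfl⟩

theorem adjoin_range_toricCoord : Algebra.adjoin k (Set.range (toricCoord k hD b hb)) = ⊤ := by
  have hrange : Set.range (toricCoord k hD b hb) =
      Ideal.Quotient.mkₐ k (toricIdeal k hD b hb).toIdeal '' Set.range MvPolynomial.X := by
    rw [← Set.range_comp]
    rfl
  rw [hrange, ← AlgHom.map_adjoin, MvPolynomial.adjoin_range_X, Algebra.map_top,
    AlgHom.range_eq_top]
  exact Ideal.Quotient.mkₐ_surjective _ _

theorem isHomogeneous_toricEval {m : ℕ} {x : toricRing k hD b hb}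
    (hx : x ∈ toricGrading k hD b hb m) : (toricEval k hD b hb x).IsHomogeneous (D * m) := by
  obtain ⟨p, hp, rfl⟩ := hx
  exact toricHom_isHomogeneous k hb hp

/-- Evaluation of the homogeneous coordinates at `t_j = 1`. -/
noncomputable def affineEval (j : Fin (d + 1)) :
    toricRing k hD b hb →ₐ[k] MvPolynomial {i // i ≠ j} k :=
  (dehomogenize k j).comp (toricEval k hD b hb)

theorem affineEval_coord (j : Fin (d + 1)) (l : Fin (n + 1)) :
    affineEval k hD b hb j (toricCoord k hD b hb l) =
      MvPolynomial.monomial (chartExponent j (b l)) 1 := by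
  rw [affineEval, AlgHom.comp_apply, toricEval_coord, dehomogenize_monomial,
    Finsupp.coe_equivFunOnFinite_symm]

theorem affineEval_injOn (j : Fin (d + 1)) (m : ℕ) :
    Set.InjOn (affineEval k hD b hb j) (toricGrading k hD b hb m) :=
  (dehomogenize_injOn k j (D * m)).comp (toricEval_injective k hD b hb).injOn
    fun _ hx => isHomogeneous_toricEval k hD b hb hx

/-- The monoid of exponents of the chart of `X_b` at the vertex `D e_j`. -/
noncomputable abbrev chartMonoid (j : Fin (d + 1)) : AddSubmonoid ({i // i ≠ j} →₀ ℕ) :=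
  AddSubmonoid.closure (Set.range fun l => chartExponent j (b l))

theorem range_affineEval (j : Fin (d + 1)) : (affineEval k hD b hb j).range =
    (AddMonoidAlgebra.mapDomainAlgHom k k (chartMonoid b j).subtype).range := by
  rw [chartMonoid, range_mapDomainAlgHom_closure, ← Set.range_comp, ← Algebra.map_top,
    ← adjoin_range_toricCoord, AlgHom.map_adjoin, ← Set.range_comp]
  exact congrArg (fun s => Algebra.adjoin k (Set.range s))
    (funext fun l => affineEval_coord k hD b hb j l)

variable {b}

/-- The coordinate ring of the chart of `X_b` at the vertex `D e_j`, as a monoid algebra. -/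
noncomputable def vertexChartEquiv {j : Fin (d + 1)} {v : Fin (n + 1)} (hv : b v = Pi.single j D) :
    HomogeneousLocalization.Away (toricGrading k hD b hb) (toricCoord k hD b hb v) ≃ₐ[k]
      AddMonoidAlgebra k (chartMonoid b j) :=
  have hvertex : affineEval k hD b hb j (toricCoord k hD b hb v) = 1 := by
    rw [affineEval_coord, hv, chartExponent_single_self]
    rfl
  (awayEquivRange _ (toricCoord_mem k hD b hb v) hvertex (affineEval_injOn k hD b hb j)).trans <|
    (Subalgebra.equivOfEq _ _ (range_affineEval k hD b hb j)).trans
      (AlgEquiv.ofInjective _ (AddMonoidAlgebra.mapDomain_injective Subtype.val_injective)).symm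

variable {u : Fin (d + 1) → Fin (n + 1)} (hu : ∀ j, b (u j) = Pi.single j D)
include hu

theorem toricCoord_pow (l : Fin (n + 1)) :
    toricCoord k hD b hb l ^ D = ∏ j, toricCoord k hD b hb (u j) ^ b l j := by
  apply toricEval_injective
  simp only [map_pow, map_prod, toricEval_coord, MvPolynomial.monomial_pow, one_pow, hu]
  rw [← MvPolynomial.monomial_sum_one]
  congr 2
  ext i
  simp [Finsupp.finsetSum_apply, Finsupp.single_apply, mul_comm]

open AlgebraicGeometry

omit hu in
theorem iSup_basicOpen_toricCoord :
    ⨆ l, Proj.basicOpen (toricGrading k hD b hb) (toricCoord k hD b hb l) = ⊤ := by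
  refine Proj.iSup_basicOpen_eq_top' _ _ (fun l => ⟨1, toricCoord_mem k hD b hb l⟩) ?_
  rw [eq_top_iff]
  rintro x -
  have hx : x ∈ Algebra.adjoin k (Set.range (toricCoord k hD b hb)) :=
    adjoin_range_toricCoord k hD b hb ▸ Algebra.mem_top
  induction hx using Algebra.adjoin_induction with
  | mem x hx => exact Algebra.subset_adjoin hx
  | algebraMap r => exact Subalgebra.algebraMap_mem _ (algebraMap k (toricGrading k hD b hb 0) r)
  | add x y _ _ hx hy => exact add_mem hx hy
  | mul x y _ _ hx hy => exact mul_mem hx hy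

theorem iSup_basicOpen_vertex :
    ⨆ j, Proj.basicOpen (toricGrading k hD b hb) (toricCoord k hD b hb (u j)) = ⊤ := by
  rw [eq_top_iff, ← iSup_basicOpen_toricCoord k hD hb, iSup_le_iff]
  intro l
  obtain ⟨j, -, hj⟩ : ∃ j ∈ Finset.univ, b l j ≠ 0 :=
    Finset.exists_ne_zero_of_sum_ne_zero (by rw [hb l]; exact hD.ne')
  refine le_trans ?_ (le_iSup _ j)
  rw [← Proj.basicOpen_pow _ _ D hD, toricCoord_pow k hD hb hu]
  exact Proj.basicOpen_mono _ _ _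
    ((dvd_pow_self _ hj).trans (Finset.dvd_prod_of_mem _ (Finset.mem_univ j)))

theorem smooth_toricVarietyToSpec_iff_forall_chart : Smooth (toricVarietyToSpec k hD b hb) ↔
    ∀ j, Algebra.Smooth k (AddMonoidAlgebra k (chartMonoid b j)) :=
  (smooth_toSpecZero_comp_iff _ (fun j => toricCoord_mem k hD b hb (u j)) (fun _ => one_pos)
      (iSup_basicOpen_vertex k hD hb hu)).trans <| forall_congr' fun j =>
    ⟨fun _ => .of_equiv (vertexChartEquiv k hD hb (hu j)),
      fun _ => .of_equiv (vertexChartEquiv k hD hb (hu j)).symm⟩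

end Toric

/-! ### The smoothness criterion -/

section Criterion

theorem eq_single_add_single_of_chartExponent {σ : Type*} [Fintype σ] [DecidableEq σ] {D α : ℕ}
    {x : σ → ℕ} (hx : ∑ i, x i = D) {i j : σ} (hij : i ≠ j)
    (h : chartExponent j x = Finsupp.single ⟨i, hij⟩ α) :
    α ≤ D ∧ x = Pi.single i α + Pi.single j (D - α) := by
  have hα : α ≤ D := by
    have hxi : x i = α := by simpa using DFunLike.congr_fun h ⟨i, hij⟩
    exact hxi ▸ hx ▸ Finset.single_le_sum (fun _ _ => zero_le) (Finset.mem_univ i)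
  refine ⟨hα, chartExponent_injOn j D hx ?_ ?_⟩
  · simp [Finset.sum_add_distrib, Nat.add_sub_cancel' hα]
  · rw [h, map_add, chartExponent_single_self, add_zero, ← chartExponent_single ⟨i, hij⟩]

variable {n d D : ℕ} {b : Fin (n + 1) → Fin (d + 1) → ℕ}

theorem chartMonoid_eq_top {j : Fin (d + 1)}
    (h : ∀ i, Pi.single i 1 + Pi.single j (D - 1) ∈ Set.range b) : chartMonoid b j = ⊤ := by
  have hsingle (i : {i // i ≠ j}) : Finsupp.single i 1 ∈ chartMonoid b j := by
    obtain ⟨l, hl⟩ := h i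
    refine AddSubmonoid.subset_closure ⟨l, ?_⟩
    simp only [hl, map_add, chartExponent_single, chartExponent_single_self, add_zero]
  rw [eq_top_iff]
  rintro y -
  induction y using Finsupp.induction_linear with
  | zero => exact zero_mem _
  | add x y hx hy => exact add_mem hx hy
  | single i m => simpa using nsmul_mem (hsingle i) m

theorem smooth_addMonoidAlgebra_of_eq_top (k : Type*) [CommRing k] {σ : Type*} [Finite σ]
    {S : AddSubmonoid (σ →₀ ℕ)} (h : S = ⊤) : Algebra.Smooth k (AddMonoidAlgebra k S) := by
  subst h
  have : Algebra.Smooth k (MvPolynomial σ k) := ⟨inferInstance, inferInstance⟩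
  exact .of_equiv (AddMonoidAlgebra.domCongr k k AddSubmonoid.topEquiv.symm :
    MvPolynomial σ k ≃ₐ[k] _)

variable (hb : ∀ l, ∑ i, b l i = D) (hvert : ∀ i, Pi.single i D ∈ Set.range b)
include hb hvert

theorem exists_single_add_single_mem_forall_dvd (k : Type*) [Field k] (hD : 0 < D)
    {i j : Fin (d + 1)} (hij : i ≠ j)
    [Algebra.FormallySmooth k (AddMonoidAlgebra k (chartMonoid b j))] :
    ∃ α ≤ D, (∀ l, α ∣ b l i) ∧ Pi.single i α + Pi.single j (D - α) ∈ Set.range b := by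
  have haxis (i : {i // i ≠ j}) : ∃ m ≠ 0, Finsupp.single i m ∈ chartMonoid b j := by
    obtain ⟨l, hl⟩ := hvert i
    exact ⟨D, hD.ne', AddSubmonoid.subset_closure ⟨l, by simp only [hl, chartExponent_single]⟩⟩
  obtain ⟨α, -, ⟨l, hl⟩, hdvd⟩ :=
    exists_single_mem_forall_dvd k (Set.finite_range _) haxis ⟨i, hij⟩
  obtain ⟨hα, hbl⟩ := eq_single_add_single_of_chartExponent (hb l) hij hl
  exact ⟨α, hα, fun l => hdvd _ ⟨l, rfl⟩, l, hbl⟩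

theorem single_add_single_mem_of_formallySmooth (k : Type*) [Field k] (hD : 0 < D)
    (hgcd : ∀ p, (∀ l i, p ∣ b l i) → p = 1)
    [∀ j, Algebra.FormallySmooth k (AddMonoidAlgebra k (chartMonoid b j))] (i j : Fin (d + 1)) :
    Pi.single i 1 + Pi.single j (D - 1) ∈ Set.range b := by
  obtain rfl | hij := eq_or_ne i j
  · exact single_one_add_single_pred hD i ▸ hvert i
  obtain ⟨α, -, hdvd, hmem⟩ := exists_single_add_single_mem_forall_dvd hb hvert k hD hij
  suffices hα : α = 1 by rwa [hα] at hmem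
  refine hgcd α fun l m => ?_
  obtain rfl | hm := eq_or_ne m i
  · exact hdvd l
  obtain ⟨β, hβD, hβ, q, hq⟩ := exists_single_add_single_mem_forall_dvd hb hvert k hD hm
  -- `α` divides the `i`-th coordinates `D` of `D e_i` and `D - β` of `β e_m + (D - β) e_i`.
  obtain ⟨v, hv⟩ := hvert i
  have hαD : α ∣ D := by simpa [hv] using hdvd v
  have hαβ : α ∣ D - β := by simpa [hq, hm.symm] using hdvd q
  exact ((Nat.dvd_sub_iff_right hβD hαD).1 hαβ).trans (hβ l)

theorem smooth_toricVarietyToSpec_iff (k : Type u) [Field k] (hD : 0 < D)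
    (hgcd : ∀ p, (∀ l i, p ∣ b l i) → p = 1) :
    AlgebraicGeometry.Smooth (toricVarietyToSpec k hD b hb) ↔
      ∀ i j, Pi.single i 1 + Pi.single j (D - 1) ∈ Set.range b := by
  choose u hu using id hvert
  rw [smooth_toricVarietyToSpec_iff_forall_chart k hD hb hu]
  refine ⟨fun h => ?_,
    fun h j => smooth_addMonoidAlgebra_of_eq_top k (chartMonoid_eq_top fun i => h i j)⟩
  have (j : Fin (d + 1)) := (h j).formallySmooth
  exact single_add_single_mem_of_formallySmooth hb hvert k hD hgcd

end Criterion

end SimplicialToric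

open SimplicialToric in
theorem mainTheorem10_general {k : Type*} [Field k] {n d D : ℕ} (hD : 0 < D)
    (a : Fin (n + 1) → Fin d → ℕ) (hzero : 0 ∈ Set.range a)
    (hvert : ∀ i : Fin d, Pi.single i D ∈ Set.range a) (hdeg : ∀ i, ∑ j, a i j ≤ D)
    (hgcd : (Finset.univ : Finset (Fin (n + 1) × Fin (d + 1))).gcd
      (fun p => homogenize D (a p.1) p.2) = 1) :
    List.TFAE
      [ AlgebraicGeometry.Smooth (toricVarietyToSpec k hD (fun i => homogenize D (a i))
          (fun i => sum_homogenize (hdeg i))),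
        ∀ i j : Fin (d + 1),
          Pi.single i 1 + Pi.single j (D - 1) ∈ Set.range (fun l => homogenize D (a l)),
        0 ∈ Set.range a ∧
          (∀ i : Fin d, Pi.single i 1 ∈ Set.range a ∧ Pi.single i (D - 1) ∈ Set.range a) ∧
          ∀ i j : Fin d, Pi.single i 1 + Pi.single j (D - 1) ∈ Set.range a,
        ∃ s₀ : ℕ, ∀ s ≥ s₀, sumset s (Set.range a) = simplex d D s ] := by
  have hgcd' (p : ℕ) (hp : ∀ l i, p ∣ homogenize D (a l) i) : p = 1 :=
    Nat.dvd_one.1 (hgcd ▸ Finset.dvd_gcd fun q _ => hp q.1 q.2)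
  tfae_have 1 ↔ 2 := smooth_toricVarietyToSpec_iff (fun l => sum_homogenize (hdeg l))
    (single_mem_range_homogenize hdeg hzero hvert) k hD hgcd'
  tfae_have 2 ↔ 3 := forall_single_add_single_mem_iff hdeg hD
  tfae_have 4 ↔ 2 := exists_forall_sumset_eq_simplex_iff hdeg hD
  tfae_finish

open SimplicialToric in
theorem mainTheorem10 {k : Type*} [Field k] [IsAlgClosed k] {n d D : ℕ}
    (hd : 1 ≤ d) (hn : d ≤ n) (hD : 2 ≤ D)
    (a : Fin (n + 1) → Fin d → ℕ) (ha : Function.Injective a)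
    (hzero : 0 ∈ Set.range a)
    (hvert : ∀ i : Fin d, Pi.single i D ∈ Set.range a)
    (hdeg : ∀ i, ∑ j, a i j ≤ D)
    (hgcd : (Finset.univ : Finset (Fin (n + 1) × Fin (d + 1))).gcd
      (fun p => homogenize D (a p.1) p.2) = 1) :
    List.TFAE
      [ AlgebraicGeometry.Smooth
          (toricVarietyToSpec k (D := D) (Nat.lt_of_lt_of_le Nat.zero_lt_two hD) (fun i => homogenize D (a i))
            (fun i => sum_homogenize (hdeg i))),
        ∀ i j : Fin (d + 1),
          Pi.single i 1 + Pi.single j (D - 1) ∈ Set.range (fun l => homogenize D (a l)),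
        0 ∈ Set.range a ∧
          (∀ i : Fin d, Pi.single i 1 ∈ Set.range a ∧ Pi.single i (D - 1) ∈ Set.range a) ∧
          ∀ i j : Fin d, Pi.single i 1 + Pi.single j (D - 1) ∈ Set.range a,
        ∃ s₀ : ℕ, ∀ s ≥ s₀, sumset s (Set.range a) = simplex d D s ] :=
  mainTheorem10_general (Nat.lt_of_lt_of_le Nat.zero_lt_two hD) a hzero hvert hdeg hgcd
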